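/- Theorem (Hausdorff–Young inequality for the fractional Fourier transform). Let $1<p\le 2$, $p'=p/(p-1)$ and $\alpha\in\mathbb R$; if $p<2$, assume $\alpha\notin\pi\mathbb Z$. For $\alpha\notin\pi\mathbb Z$ put $A_\alpha=\sqrt{1-i\cot\alpha}$ (principal branch) and $$K_\alpha(x,t)=A_\alpha\exp\Big[2\pi i\Big(\tfrac{t^2}{2}\cot\alpha-xt\csc\alpha+\tfrac{x^2}{2}\cot\alpha\Big)\Big].$$ For $f\in L^1(\mathbb R)$ (complex-valued), the fractional Fourier transform (FRFT) of order $\alpha$ is $(\mathcal F_\alpha f)(x)=\int_{\mathbb R}K_\alpha(x,t)f(t)\,dt$ if $\alpha\notin\pi\mathbb Z$, $(\mathcal F_\alpha f)(x)=f(x)$ if $\alpha\in2\pi\mathbb Z$, and $(\mathcal F_\alpha f)(x)=f(-x)$ if $\alpha\in\pi+2\pi\mathbb Z$. For $f\in L^2(\mathbb R)$, $\mathcal F_\alpha f$ is the limit in $L^2(\mathbb R)$ of $\mathcal F_\alpha(f\mathbf 1_{[-R,R]})$ as $R\to\infty$. For $f=f_1+f_2$ with $f_1\in L^1(\mathbb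 R)$ and $f_2\in L^2(\mathbb R)$, $\mathcal F_\alpha f=\mathcal F_\alpha f_1+\mathcal F_\alpha f_2$. Then $\mathcal F_\alpha$ is well defined on $L^p(\mathbb R)$ (every $f\in L^p(\mathbb R)$ has a transform, which up to null sets does not depend on the decomposition), it is a bounded linear operator from $L^p(\mathbb R)$ to $L^{p'}(\mathbb R)$, and $$\|\mathcal F_\alpha f\|_{p'}\le |A_\alpha|^{\frac2p-1}\,\|f\|_p\qquad\text{for all } f\in L^p(\mathbb R),$$ where for $p=2$ the constant $|A_\alpha|^{0}$ is read as $1$ for every $\alpha$. -/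

import Mathlib

open MeasureTheory Filter Topology

noncomputable section

/-- The constant `A_α = √(1 - i cot α)` (principal branch of the square root). -/
def fracFourierConst (α : ℝ) : ℂ :=
  (1 - Complex.I * (Real.cot α : ℂ)) ^ (1 / 2 : ℂ)

/-- The kernel
`K_α(x,t) = A_α exp (2πi (t²/2 · cot α - x t csc α + x²/2 · cot α))`, where `csc α = 1 / sin α`. -/
def fracFourierKernel (α x t : ℝ) : ℂ :=
  fracFourierConst α *
    Complex.exp (2 * Real.pi * Complex.I *
      ((t ^ 2 / 2 * Real.cot α - x * t * (1 / Real.sin α) + x ^ 2 / 2 * Real.cot α : ℝ) : ℂ))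

open Classical in
/-- The fractional Fourier transform of order `α` of an integrable function: the identity for
`α ∈ 2πℤ`, the reflection for `α ∈ π + 2πℤ`, and integration against `K_α` otherwise. -/
def fracFourierL1 (α : ℝ) (f : ℝ → ℂ) (x : ℝ) : ℂ :=
  if ∃ n : ℤ, α = 2 * n * Real.pi then f x
  else if ∃ n : ℤ, α = (2 * n + 1) * Real.pi then f (-x)
  else ∫ t : ℝ, fracFourierKernel α x t * f t

/-- `g` is the fractional Fourier transform of order `α` of the square-integrable function `f`:
the limit in `L²(ℝ)`, as `R → ∞`, of the transforms of the (integrable) truncations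
`f · 1_{[-R,R]}`. -/
def IsFracFourierL2 (α : ℝ) (f g : ℝ → ℂ) : Prop :=
  MemLp g 2 ∧
    Tendsto (fun R : ℝ =>
        eLpNorm (fun x => fracFourierL1 α ((Set.Icc (-R) R).indicator f) x - g x) 2 volume)
      atTop (𝓝 0)

/-- `g` is (a representative of) the fractional Fourier transform of order `α` of
`f ∈ L¹(ℝ) + L²(ℝ)`: for some decomposition `f = f₁ + f₂` with `f₁ ∈ L¹(ℝ)` and `f₂ ∈ L²(ℝ)`,
`g` is a.e. the sum of the `L¹`-transform of `f₁` and the `L²`-transform of `f₂`. -/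
def IsFracFourier (α : ℝ) (f g : ℝ → ℂ) : Prop :=
  ∃ f₁ f₂ g₂ : ℝ → ℂ, MemLp f₁ 1 ∧ MemLp f₂ 2 ∧ f =ᵐ[volume] f₁ + f₂ ∧
    IsFracFourierL2 α f₂ g₂ ∧ g =ᵐ[volume] fracFourierL1 α f₁ + g₂

end

/-! For `sin α ≠ 0` the kernel factors: `F_α` is multiplication by a chirp, then the Fourier
transform, then the dilation by `1 / sin α`, another chirp and the factor `A_α`
(`fracFourierL1_eq_fourier`). Chirps are unimodular and `|A_α|² = 1 / |sin α|` cancels the Jacobian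
of the dilation, so Plancherel makes `F_α` isometric for the `L²` norm on `L¹ ∩ L²`. Since `|K_α| =
|A_α|`, it also maps `L¹` to `L^∞` with norm at most `|A_α|`.

Riesz–Thorin interpolates with `θ = 2 - 2/p`, that is `1/p = (1 - θ) + θ/2`, and gives the constant
`|A_α|^(1-θ) = |A_α|^(2/p-1)`. It is proved on simple functions: the three lines theorem bounds the
pairing `∫ F f * g` (`IsL1L2Bounded.norm_integral_mul_le`), and duality turns this into a norm bound
(`eLpNorm_le_of_forall_simpleFunc`).

For general `f ∈ L^p`, cut `f` at height 1 into an `L¹` and an `L²` piece, and cut simple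
approximations along the same set. The transforms converge almost everywhere along a subsequence,
and Fatou preserves the bound (`exists_isFracFourier_of_stronglyMeasurable`). The transform is well
defined because the integral and the `L²` limit agree on `L¹ ∩ L²`, where two decompositions differ.
For `p = 2` only the `L²` extension is used; it covers all `α`, as identity and reflection are
isometries. -/

open scoped ENNReal

/-! ### Plancherel for the Fourier integral on `L¹ ∩ L²`. -/

open scoped FourierTransform SchwartzMap ENNReal ContDiff in
/-- The Fourier integral of a function in `L¹ ∩ L²` is its `L²` Fourier transform. -/
theorem coeFn_fourier_toLp_ae_eq {f : ℝ → ℂ} (hf1 : Integrable f) (hf2 : MemLp f 2) :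
    (𝓕 (hf2.toLp f) : Lp ℂ 2 (volume : Measure ℝ)) =ᵐ[volume] 𝓕 f := by
  have hcont : Continuous (𝓕 f) :=
    VectorFourier.fourierIntegral_continuous Real.continuous_fourierChar continuous_inner hf1
  -- Both sides are tested against smooth compactly supported `g`. In either pairing the transform
  -- moves onto `g`: by the distributional definition on the `L²` side, by Fubini on the `L¹` side.
  refine ae_eq_of_integral_contDiff_smul_eq ?_ hcont.locallyIntegrable ?_
  · exact (Lp.memLp _).locallyIntegrable (by norm_num)
  intro g hg hgc
  have hg₁ : HasCompactSupport (Complex.ofRealCLM ∘ g) := hgc.comp_left rfl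
  have hg₂ : ContDiff ℝ ∞ (Complex.ofRealCLM ∘ g) := by fun_prop
  set G : 𝓢(ℝ, ℂ) := hg₁.toSchwartzMap hg₂ with hG
  have hGx : ∀ x, G x = (g x : ℂ) := fun x => rfl
  have key := congrArg (fun T => T G) (Lp.fourier_toTemperedDistribution_eq (hf2.toLp f))
  simp only [TemperedDistribution.fourier_apply, Lp.toTemperedDistribution_apply] at key
  have h1 : ∫ x, g x • (𝓕 (hf2.toLp f) : Lp ℂ 2 (volume : Measure ℝ)) x
      = ∫ x, (𝓕 G) x • (hf2.toLp f) x := by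
    rw [key]
    refine integral_congr_ae (Eventually.of_forall fun x => ?_)
    simp [hGx]
  have h2 : ∫ x, (𝓕 G) x • (hf2.toLp f) x = ∫ x, (𝓕 (G : ℝ → ℂ)) x • f x := by
    refine integral_congr_ae ?_
    filter_upwards [hf2.coeFn_toLp] with x hx
    rw [hx, SchwartzMap.fourier_coe]
  have h3 : ∫ x, (𝓕 (G : ℝ → ℂ)) x • f x = ∫ x, G x • 𝓕 f x := by
    simpa using! (VectorFourier.integral_fourierIntegral_smul_eq_flip (L := innerₗ ℝ)
      Real.continuous_fourierChar continuous_inner G.integrable hf1)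
  rw [h1, h2, h3]
  refine integral_congr_ae (Eventually.of_forall fun x => ?_)
  simp [hGx]

open scoped FourierTransform in
/-- Plancherel's theorem for the Fourier integral of a function in `L¹ ∩ L²`. -/
theorem eLpNorm_fourier_two {f : ℝ → ℂ} (hf1 : Integrable f) (hf2 : MemLp f 2) :
    eLpNorm (𝓕 f) 2 volume = eLpNorm f 2 volume := by
  rw [← eLpNorm_congr_ae (coeFn_fourier_toLp_ae_eq hf1 hf2),
    ← eLpNorm_congr_ae hf2.coeFn_toLp, ← ENNReal.toReal_eq_toReal_iff' (Lp.eLpNorm_ne_top _)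
    (Lp.eLpNorm_ne_top _)]
  exact Lp.norm_fourier_eq (hf2.toLp f)

/-! ### Abstract operators contracting the `L²` norm. -/

/-- A map which is linear on `L¹` and contracts the `L²` seminorm on `L¹ ∩ L²`. -/
structure IsL2Contraction {X : Type*} [MeasurableSpace X] (μ : Measure X)
    (F : (X → ℂ) → X → ℂ) : Prop where
  congr : ∀ {f g : X → ℂ}, f =ᵐ[μ] g → F f =ᵐ[μ] F g
  add : ∀ {f g : X → ℂ}, Integrable f μ → Integrable g μ → F (f + g) =ᵐ[μ] F f + F g
  smul : ∀ (c : ℂ) {f : X → ℂ}, Integrable f μ → F (c • f) =ᵐ[μ] c • F f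
  aestronglyMeasurable : ∀ {f : X → ℂ}, Integrable f μ → AEStronglyMeasurable (F f) μ
  eLpNorm_two_le : ∀ {f : X → ℂ}, Integrable f μ → MemLp f 2 μ →
    eLpNorm (F f) 2 μ ≤ eLpNorm f 2 μ

namespace IsL2Contraction

variable {X : Type*} [MeasurableSpace X] {μ : Measure X} {F : (X → ℂ) → X → ℂ}

theorem zero (hF : IsL2Contraction μ F) : F 0 =ᵐ[μ] 0 := by
  simpa using hF.smul 0 (integrable_zero X ℂ μ)

theorem sub (hF : IsL2Contraction μ F) {f g : X → ℂ} (hf : Integrable f μ) (hg : Integrable g μ) :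
    F (f - g) =ᵐ[μ] F f - F g := by
  have h1 := hF.add hf (hg.smul (-1 : ℂ))
  have h2 := hF.smul (-1) hg
  have h3 : f - g = f + (-1 : ℂ) • g := by simp [sub_eq_add_neg]
  rw [h3]
  filter_upwards [h1, h2] with x hx1 hx2
  rw [hx1, Pi.add_apply, hx2]
  simp [sub_eq_add_neg]

theorem memLp_two (hF : IsL2Contraction μ F) {f : X → ℂ} (hf : Integrable f μ)
    (hf2 : MemLp f 2 μ) : MemLp (F f) 2 μ :=
  ⟨hF.aestronglyMeasurable hf, (hF.eLpNorm_two_le hf hf2).trans_lt hf2.2⟩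

theorem sum_smul (hF : IsL2Contraction μ F) {ι : Type*} (s : Finset ι) (c : ι → ℂ)
    (e : ι → X → ℂ) (he : ∀ i ∈ s, Integrable (e i) μ) :
    F (∑ i ∈ s, c i • e i) =ᵐ[μ] ∑ i ∈ s, c i • F (e i) := by
  classical
  induction s using Finset.induction_on with
  | empty => simpa using hF.zero
  | insert a s ha ih =>
    rw [Finset.sum_insert ha, Finset.sum_insert ha]
    have hs : ∀ i ∈ s, Integrable (e i) μ := fun i hi => he i (Finset.mem_insert_of_mem hi)
    have h1 := hF.add ((he a (Finset.mem_insert_self a s)).smul (c a))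
      (integrable_finsetSum' s (fun i hi => (hs i hi).smul (c i)))
    filter_upwards [h1, ih hs, hF.smul (c a) (he a (Finset.mem_insert_self a s))] with x h1 h2 h3
    rw [h1, Pi.add_apply, Pi.add_apply, h2, h3]

end IsL2Contraction

/-! ### Riesz–Thorin interpolation on simple functions. -/

/-- The analytic family `w / |w| * |w| ^ (p * (1 - z / 2))` through a complex number `w`. -/
noncomputable def powFamily (p : ℝ) (z w : ℂ) : ℂ :=
  if w = 0 then 0 else w / ‖w‖ * Complex.exp (p * (1 - z / 2) * Real.log ‖w‖)

@[simp] theorem powFamily_zero (p : ℝ) (z : ℂ) : powFamily p z 0 = 0 := by simp [powFamily]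

theorem norm_powFamily {p : ℝ} {z : ℂ} (hp : 0 < p) (hz : z.re ≤ 1) (w : ℂ) :
    ‖powFamily p z w‖ = ‖w‖ ^ (p * (1 - z.re / 2)) := by
  by_cases hw : w = 0
  · have : p * (1 - z.re / 2) ≠ 0 := by
      have : 0 < 1 - z.re / 2 := by linarith
      positivity
    simp [hw, Real.zero_rpow this]
  · have h : 0 < ‖w‖ := norm_pos_iff.2 hw
    rw [powFamily, if_neg hw, norm_mul, Complex.norm_exp, Real.rpow_def_of_pos h]
    have h1 : ‖w / (‖w‖ : ℂ)‖ = 1 := by simp [h.ne']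
    rw [h1, one_mul]
    congr 1
    have : (p * (1 - z / 2) * Real.log ‖w‖ : ℂ)
        = ((p * Real.log ‖w‖ : ℝ) : ℂ) * (1 - z / 2) := by push_cast; ring
    rw [this, Complex.re_ofReal_mul]
    have h2 : (1 - z / 2 : ℂ).re = 1 - z.re / 2 := by simp
    rw [h2]; ring

/-- The interpolation point is the zero of `p * (1 - z / 2) - 1`, where the family returns the
original value. -/
theorem powFamily_eq_self {p : ℝ} (hp : 0 < p) (w : ℂ) :
    powFamily p ((2 - 2 / p : ℝ) : ℂ) w = w := by
  by_cases hw : w = 0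
  · simp [hw]
  · have h : 0 < ‖w‖ := norm_pos_iff.2 hw
    have hpc : (p : ℂ) ≠ 0 := by exact_mod_cast hp.ne'
    have h1 : (p * (1 - ((2 - 2 / p : ℝ) : ℂ) / 2) * Real.log ‖w‖ : ℂ) = (Real.log ‖w‖ : ℝ) := by
      push_cast; field_simp; ring
    rw [powFamily, if_neg hw, h1, ← Complex.ofReal_exp, Real.exp_log h]
    have : (‖w‖ : ℂ) ≠ 0 := by exact_mod_cast h.ne'
    field_simp

theorem differentiable_powFamily (p : ℝ) (w : ℂ) :
    Differentiable ℂ fun z => powFamily p z w := by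
  by_cases hw : w = 0
  · simp [hw]
  · simp only [powFamily, if_neg hw]
    fun_prop

/-- On the strip the exponent lies between `p / 2` and `p`; enlarging the base to at least 1 makes
the bound uniform in `z`. -/
theorem norm_powFamily_le {p : ℝ} {z : ℂ} (hp : 0 < p) (h0 : 0 ≤ z.re) (h1 : z.re ≤ 1) (w : ℂ) :
    ‖powFamily p z w‖ ≤ (1 + ‖w‖) ^ p := by
  rw [norm_powFamily hp h1]
  calc ‖w‖ ^ (p * (1 - z.re / 2)) ≤ (1 + ‖w‖) ^ (p * (1 - z.re / 2)) := by
        apply Real.rpow_le_rpow (norm_nonneg _) (by linarith)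
        have : 0 ≤ 1 - z.re / 2 := by linarith
        positivity
    _ ≤ (1 + ‖w‖) ^ p := by
        apply Real.rpow_le_rpow_of_exponent_le (by linarith [norm_nonneg w])
        nlinarith

theorem MeasureTheory.SimpleFunc.map_eq_sum_indicator {X : Type*} [MeasurableSpace X]
    (f : SimpleFunc X ℂ) {h : ℂ → ℂ} (h0 : h 0 = 0) :
    ⇑(f.map h) = ∑ y ∈ f.range.filter (· ≠ 0), h y • (f ⁻¹' {y}).indicator 1 := by
  classical
  ext x
  simp only [SimpleFunc.coe_map, Function.comp_apply, Finset.sum_apply, Pi.smul_apply,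
    Set.indicator_apply, Set.mem_preimage, Set.mem_singleton_iff, Pi.one_apply, smul_eq_mul,
    mul_ite, mul_one, mul_zero, Finset.sum_ite_eq, Finset.mem_filter, SimpleFunc.mem_range,
    Set.mem_range_self, true_and]
  split_ifs with hx
  · rfl
  · push Not at hx; rw [hx, h0]

section

variable {X : Type*} [MeasurableSpace X] {μ : Measure X} {F : (X → ℂ) → X → ℂ}

theorem memLp_indicator_fiber {f : SimpleFunc X ℂ} (hf : Integrable f μ) {y : ℂ} (hy : y ≠ 0)
    (q : ℝ≥0∞) : MemLp ((f ⁻¹' {y}).indicator (1 : X → ℂ)) q μ :=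
  memLp_indicator_const q (f.measurableSet_fiber y) 1
    (Or.inr (SimpleFunc.measure_preimage_lt_top_of_integrable f hf hy).ne)

/-- Linearity isolates the dependence on `h` in finitely many scalar coefficients. With `h =
powFamily p z` the pairing thus becomes a finite sum of entire functions of `z`. The fibre over 0,
possibly of infinite measure, drops out because `h 0 = 0`. -/
theorem integral_map_mul_map (hF : IsL2Contraction μ F) {f g : SimpleFunc X ℂ}
    (hf : Integrable f μ) (hg : Integrable g μ) {h : ℂ → ℂ} (h0 : h 0 = 0) :
    ∫ x, F (f.map h) x * g.map h x ∂μ =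
      ∑ y ∈ f.range.filter (· ≠ 0), ∑ y' ∈ g.range.filter (· ≠ 0), h y * h y' *
        ∫ x, F ((f ⁻¹' {y}).indicator 1) x * (g ⁻¹' {y'}).indicator 1 x ∂μ := by
  have hfi : ∀ y ∈ f.range.filter (· ≠ 0), Integrable ((f ⁻¹' {y}).indicator (1 : X → ℂ)) μ :=
    fun y hy => memLp_one_iff_integrable.1 (memLp_indicator_fiber hf (Finset.mem_filter.1 hy).2 1)
  have h1 : ∫ x, F (f.map h) x * g.map h x ∂μ =
      ∫ x, ∑ y ∈ f.range.filter (· ≠ 0), ∑ y' ∈ g.range.filter (· ≠ 0), h y * h y' *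
        (F ((f ⁻¹' {y}).indicator 1) x * (g ⁻¹' {y'}).indicator 1 x) ∂μ := by
    rw [f.map_eq_sum_indicator h0, g.map_eq_sum_indicator h0]
    refine integral_congr_ae ?_
    filter_upwards [hF.sum_smul (f.range.filter (· ≠ 0)) h
      (fun y => (f ⁻¹' {y}).indicator (1 : X → ℂ)) hfi] with x hx
    rw [hx]
    simp only [Finset.sum_apply, Pi.smul_apply, smul_eq_mul, Finset.sum_mul_sum]
    refine Finset.sum_congr rfl fun y _ => Finset.sum_congr rfl fun y' _ => by ring
  have h2 : ∀ y ∈ f.range.filter (· ≠ 0), ∀ y' ∈ g.range.filter (· ≠ 0),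
      Integrable (fun x => h y * h y' *
        (F ((f ⁻¹' {y}).indicator 1) x * (g ⁻¹' {y'}).indicator 1 x)) μ := by
    intro y hy y' hy'
    refine Integrable.const_mul ?_ _
    exact (hF.memLp_two (hfi y hy)
      (memLp_indicator_fiber hf (Finset.mem_filter.1 hy).2 2)).integrable_mul
      (memLp_indicator_fiber hg (Finset.mem_filter.1 hy').2 2)
  rw [h1, integral_finsetSum _ fun y hy => integrable_finsetSum _ fun y' hy' => h2 y hy y' hy']
  refine Finset.sum_congr rfl fun y hy => ?_
  rw [integral_finsetSum _ fun y' hy' => h2 y hy y' hy']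
  refine Finset.sum_congr rfl fun y' hy' => ?_
  rw [integral_const_mul]

theorem norm_integral_mul_le_eLpNorm {p q : ℝ≥0∞} [p.HolderConjugate q] {u v : X → ℂ}
    (hu : MemLp u p μ) (hv : MemLp v q μ) :
    ‖∫ x, u x * v x ∂μ‖ ≤ (eLpNorm u p μ).toReal * (eLpNorm v q μ).toReal := by
  have h1 : ‖∫ x, u x * v x ∂μ‖ₑ ≤ eLpNorm u p μ * eLpNorm v q μ :=
    calc ‖∫ x, u x * v x ∂μ‖ₑ ≤ ∫⁻ x, ‖u x * v x‖ₑ ∂μ := enorm_integral_le_lintegral_enorm _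
      _ = eLpNorm (u • v) 1 μ := by rw [eLpNorm_one_eq_lintegral_enorm]; rfl
      _ ≤ _ := eLpNorm_smul_le_mul_eLpNorm hv.1 hu.1
  have h2 := ENNReal.toReal_mono (ENNReal.mul_ne_top hu.2.ne hv.2.ne) h1
  rwa [toReal_enorm, ENNReal.toReal_mul] at h2

/-- Used with `s = 1` on the edge `Re z = 0` and with `s = 2` on the edge `Re z = 1`. -/
theorem eLpNorm_map_powFamily {p : ℝ} (hp : 0 < p) {z : ℂ} {s : ℝ} (hz : z.re ≤ 1)
    (hs : 0 < s) (hps : s * (1 - z.re / 2) = 1) (f : SimpleFunc X ℂ) :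
    eLpNorm (f.map (powFamily p z)) (ENNReal.ofReal s) μ =
      eLpNorm f (ENNReal.ofReal p) μ ^ (p * (1 - z.re / 2)) := by
  have hz' : 0 < 1 - z.re / 2 := by linarith
  have h := eLpNorm_norm_rpow (p := ENNReal.ofReal s) (μ := μ) f
    (q := p * (1 - z.re / 2)) (by positivity)
  rw [← ENNReal.ofReal_mul hs.le, show s * (p * (1 - z.re / 2)) = p by
    rw [mul_left_comm, hps, mul_one]] at h
  rw [← h]
  refine eLpNorm_congr_norm_ae (Eventually.of_forall fun x => ?_)
  rw [SimpleFunc.map_apply, norm_powFamily hp hz, Real.norm_of_nonneg (by positivity)]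

end

/-- An `L²` contraction which is moreover bounded from `L¹` to `L^∞`, with norm at most `M`. -/
structure IsL1L2Bounded {X : Type*} [MeasurableSpace X] (μ : Measure X) (M : ℝ)
    (F : (X → ℂ) → X → ℂ) : Prop extends IsL2Contraction μ F where
  nonneg : 0 ≤ M
  eLpNorm_top_le : ∀ {f : X → ℂ}, Integrable f μ →
    eLpNorm (F f) ∞ μ ≤ ENNReal.ofReal M * eLpNorm f 1 μ

section

variable {X : Type*} [MeasurableSpace X] {μ : Measure X} {F : (X → ℂ) → X → ℂ} {M p : ℝ}

theorem SimpleFunc.memLp_of_integrable {f : SimpleFunc X ℂ} (hf : Integrable f μ)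
    (q : ℝ≥0∞) : MemLp f q μ := by
  rcases eq_or_ne q 0 with rfl | h0
  · exact f.memLp_zero μ
  rcases eq_or_ne q ∞ with rfl | h1
  · exact f.memLp_top μ
  exact (SimpleFunc.memLp_iff_integrable h0 h1).2 hf

theorem SimpleFunc.integrable_map {f : SimpleFunc X ℂ} (hf : Integrable f μ) {h : ℂ → ℂ}
    (h0 : h 0 = 0) : Integrable (f.map h) μ :=
  SimpleFunc.integrable_iff_finMeasSupp.2 ((SimpleFunc.integrable_iff_finMeasSupp.1 hf).map h0)

theorem IsL1L2Bounded.memLp_top (hF : IsL1L2Bounded μ M F) {f : X → ℂ} (hf : Integrable f μ) :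
    MemLp (F f) ∞ μ :=
  ⟨hF.aestronglyMeasurable hf, (hF.eLpNorm_top_le hf).trans_lt
    (ENNReal.mul_lt_top ENNReal.ofReal_lt_top (memLp_one_iff_integrable.2 hf).2)⟩

theorem differentiable_integral_powFamily (hF : IsL2Contraction μ F) {f g : SimpleFunc X ℂ}
    (hf : Integrable f μ) (hg : Integrable g μ) :
    Differentiable ℂ fun z => ∫ x, F (f.map (powFamily p z)) x * g.map (powFamily p z) x ∂μ := by
  simp_rw [integral_map_mul_map hF hf hg (powFamily_zero p _)]
  refine Differentiable.fun_sum fun y _ => Differentiable.fun_sum fun y' _ => ?_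
  exact ((differentiable_powFamily p y).mul (differentiable_powFamily p y')).mul_const _

theorem bddAbove_integral_powFamily (hF : IsL2Contraction μ F) (hp : 0 < p) {f g : SimpleFunc X ℂ}
    (hf : Integrable f μ) (hg : Integrable g μ) :
    BddAbove ((norm ∘ fun z =>
      ∫ x, F (f.map (powFamily p z)) x * g.map (powFamily p z) x ∂μ) ''
        Complex.HadamardThreeLines.verticalClosedStrip 0 1) := by
  refine ⟨∑ y ∈ f.range.filter (· ≠ 0), ∑ y' ∈ g.range.filter (· ≠ 0),
    (1 + ‖y‖) ^ p * (1 + ‖y'‖) ^ p *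
      ‖∫ x, F ((f ⁻¹' {y}).indicator 1) x * (g ⁻¹' {y'}).indicator 1 x ∂μ‖, ?_⟩
  rintro _ ⟨z, hz, rfl⟩
  simp only [Complex.HadamardThreeLines.verticalClosedStrip, Set.mem_preimage, Set.mem_Icc] at hz
  simp only [Function.comp_apply, integral_map_mul_map hF hf hg (powFamily_zero p _)]
  refine (norm_sum_le _ _).trans (Finset.sum_le_sum fun y _ => (norm_sum_le _ _).trans
    (Finset.sum_le_sum fun y' _ => ?_))
  rw [norm_mul, norm_mul]
  gcongr
  · exact norm_powFamily_le hp hz.1 hz.2 y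
  · exact norm_powFamily_le hp hz.1 hz.2 y'

/-- The bilinear form of the **Riesz–Thorin theorem** between `L¹ → L^∞` and `L² → L²`, on simple
functions. -/
theorem IsL1L2Bounded.norm_integral_mul_le (hF : IsL1L2Bounded μ M F) (hp : 1 ≤ p) (hp2 : p ≤ 2)
    {f g : SimpleFunc X ℂ} (hf : Integrable f μ) (hg : Integrable g μ) :
    ‖∫ x, F f x * g x ∂μ‖ ≤ M ^ (2 / p - 1) * (eLpNorm f (ENNReal.ofReal p) μ).toReal *
      (eLpNorm g (ENNReal.ofReal p) μ).toReal := by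
  have hp0 : 0 < p := by linarith
  set a := (eLpNorm f (ENNReal.ofReal p) μ).toReal with ha
  set b := (eLpNorm g (ENNReal.ofReal p) μ).toReal with hb
  have ha0 : 0 ≤ a := ENNReal.toReal_nonneg
  have hb0 : 0 ≤ b := ENNReal.toReal_nonneg
  have hfi : ∀ z, Integrable (f.map (powFamily p z)) μ := fun z =>
    SimpleFunc.integrable_map hf (powFamily_zero p z)
  have hgi : ∀ z, Integrable (g.map (powFamily p z)) μ := fun z =>
    SimpleFunc.integrable_map hg (powFamily_zero p z)
  -- One family serves both `f` and `g`, since at each endpoint the test function lies in the same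
  -- space as the input. No normalisation of `f` and `g` is needed: the powers of their norms
  -- combine to exponent 1 at `z = 2 - 2 / p`.
  have key := Complex.HadamardThreeLines.norm_le_interp_of_mem_verticalClosedStrip₀₁'
    (fun z => ∫ x, F (f.map (powFamily p z)) x * g.map (powFamily p z) x ∂μ)
    (z := ((2 - 2 / p : ℝ) : ℂ)) (a := M * (a ^ p * b ^ p)) (b := a ^ (p / 2) * b ^ (p / 2))
    ?_ (differentiable_integral_powFamily hF.toIsL2Contraction hf hg).diffContOnCl
    (bddAbove_integral_powFamily hF.toIsL2Contraction hp0 hf hg) ?_ ?_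
  · have e1 : f.map (powFamily p ((2 - 2 / p : ℝ) : ℂ)) = f := by
      ext x; simp only [SimpleFunc.map_apply, powFamily_eq_self hp0]
    have e2 : g.map (powFamily p ((2 - 2 / p : ℝ) : ℂ)) = g := by
      ext x; simp only [SimpleFunc.map_apply, powFamily_eq_self hp0]
    simp only [e1, e2, Complex.ofReal_re] at key
    refine key.trans_eq ?_
    rw [← Real.mul_rpow ha0 hb0, ← Real.mul_rpow ha0 hb0,
      Real.mul_rpow hF.nonneg (by positivity), ← Real.rpow_mul (by positivity),
      ← Real.rpow_mul (by positivity), mul_assoc, mul_assoc,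
      ← Real.rpow_add_of_nonneg (by positivity)]
    · have e3 : p * (1 - (2 - 2 / p)) + p / 2 * (2 - 2 / p) = 1 := by field_simp; ring
      rw [e3, Real.rpow_one]
      congr 2; ring
    · have : 1 - (2 - 2 / p) = (2 - p) / p := by field_simp; ring
      rw [this]
      have : 0 ≤ 2 - p := by linarith
      positivity
    · have : 2 - 2 / p = 2 * (p - 1) / p := by field_simp
      rw [this]
      have : 0 ≤ p - 1 := by linarith
      positivity
  · simp only [Complex.HadamardThreeLines.verticalClosedStrip, Set.mem_preimage, Set.mem_Icc,
      Complex.ofReal_re]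
    have : 1 ≤ 2 / p := by rwa [le_div_iff₀ hp0, one_mul]
    have : 2 / p ≤ 2 := div_le_self (by norm_num) hp
    constructor <;> linarith
  -- Edge `Re z = 0`: the `L¹ → L^∞` bound paired with `L¹`.
  · intro z hz
    simp only [Set.mem_preimage, Set.mem_singleton_iff] at hz
    have e : ∀ u : SimpleFunc X ℂ, (eLpNorm (u.map (powFamily p z)) 1 μ).toReal =
        (eLpNorm u (ENNReal.ofReal p) μ).toReal ^ p := fun u => by
      have := eLpNorm_map_powFamily (μ := μ) hp0 (z := z) (s := 1) (by simp [hz]) one_pos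
        (by simp [hz]) u
      rw [ENNReal.ofReal_one] at this
      rw [this, hz, ENNReal.toReal_rpow]; norm_num
    have h1 := hF.eLpNorm_top_le (hfi z)
    have h2 := ENNReal.toReal_mono (ENNReal.mul_ne_top ENNReal.ofReal_ne_top
      (memLp_one_iff_integrable.2 (hfi z)).2.ne) h1
    rw [ENNReal.toReal_mul, ENNReal.toReal_ofReal hF.nonneg, e f] at h2
    refine (norm_integral_mul_le_eLpNorm (p := ∞) (q := 1) (hF.memLp_top (hfi z))
      (memLp_one_iff_integrable.2 (hgi z))).trans ?_
    rw [e g, ← mul_assoc]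
    gcongr
  -- Edge `Re z = 1`: the `L²` contraction and Cauchy–Schwarz.
  · intro z hz
    simp only [Set.mem_preimage, Set.mem_singleton_iff] at hz
    have e : ∀ u : SimpleFunc X ℂ, (eLpNorm (u.map (powFamily p z)) 2 μ).toReal =
        (eLpNorm u (ENNReal.ofReal p) μ).toReal ^ (p / 2) := fun u => by
      have := eLpNorm_map_powFamily (μ := μ) hp0 (z := z) (s := 2) (by simp [hz]) two_pos
        (by rw [hz]; norm_num) u
      rw [ENNReal.ofReal_ofNat] at this
      rw [this, hz, ENNReal.toReal_rpow]; congr 2; ring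
    have hf2 := SimpleFunc.memLp_of_integrable (hfi z) 2
    have hg2 := SimpleFunc.memLp_of_integrable (hgi z) 2
    have h2 := ENNReal.toReal_mono hf2.2.ne (hF.eLpNorm_two_le (hfi z) hf2)
    rw [e f] at h2
    refine (norm_integral_mul_le_eLpNorm (p := 2) (q := 2)
      (hF.toIsL2Contraction.memLp_two (hfi z) hf2) hg2).trans ?_
    rw [e g]
    gcongr

/-! ### From the bilinear bound to a norm bound by duality. -/

/-- A function bounded and in `L²` is in `L^q` for all `2 ≤ q < ∞`. -/
theorem MemLp.of_two_of_top {h : X → ℂ} (h2 : MemLp h 2 μ) (htop : MemLp h ∞ μ) {q : ℝ}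
    (hq : 2 ≤ q) : MemLp h (ENNReal.ofReal q) μ := by
  have hq0 : 0 < q := by linarith
  set C := (eLpNorm h ∞ μ).toReal with hC
  have hbd : ∀ᵐ x ∂μ, ‖h x‖ ≤ C := by
    filter_upwards [ae_le_eLpNormEssSup (f := h) (μ := μ)] with x hx
    rw [← eLpNorm_exponent_top] at hx
    exact (toReal_enorm (h x)).symm.trans_le (ENNReal.toReal_mono htop.2.ne hx)
  rw [← integrable_norm_rpow_iff h2.1 (by simpa using hq0) ENNReal.ofReal_ne_top,
    ENNReal.toReal_ofReal hq0.le]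
  have h3 : Integrable (fun x => C ^ (q - 2) * ‖h x‖ ^ (2 : ℝ)) μ := by
    have := (integrable_norm_rpow_iff h2.1 two_ne_zero ENNReal.ofNat_ne_top).2 h2
    simp only [ENNReal.toReal_ofNat] at this
    exact this.const_mul _
  refine h3.mono' (h2.1.norm.aemeasurable.pow_const q).aestronglyMeasurable ?_
  filter_upwards [hbd] with x hx
  rw [Real.norm_of_nonneg (by positivity)]
  calc ‖h x‖ ^ q = ‖h x‖ ^ (q - 2) * ‖h x‖ ^ (2 : ℝ) := by
        rw [← Real.rpow_add_of_nonneg (norm_nonneg _) (by linarith) (by norm_num)]; ring_nf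
    _ ≤ _ := by gcongr

/-- Converse of Hölder's inequality, tested on simple functions. -/
theorem eLpNorm_le_of_forall_simpleFunc {q : ℝ} (hpq : p.HolderConjugate q) {h : X → ℂ}
    (hh : MemLp h (ENNReal.ofReal q) μ) {C : ℝ} (hC0 : 0 ≤ C)
    (hC : ∀ g : SimpleFunc X ℂ, Integrable g μ →
      ‖∫ x, h x * g x ∂μ‖ ≤ C * (eLpNorm g (ENNReal.ofReal p) μ).toReal) :
    (eLpNorm h (ENNReal.ofReal q) μ).toReal ≤ C := by
  have hp0 : 0 < p := hpq.pos
  have hq0 : 0 < q := hpq.symm.pos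
  have hq1 : 0 < q - 1 := hpq.symm.sub_one_pos
  have hpq' : p * (q - 1) = q := by have := hpq.mul_eq_add; linarith
  have hpE : ENNReal.ofReal p ≠ 0 := by simpa using hp0
  have hp1E : 1 ≤ ENNReal.ofReal p := by simpa using hpq.lt.le
  have : (ENNReal.ofReal q).HolderConjugate (ENNReal.ofReal p) := hpq.symm.ennrealOfReal
  set N := (eLpNorm h (ENNReal.ofReal q) μ).toReal with hN
  have hN0 : 0 ≤ N := ENNReal.toReal_nonneg
  -- The extremal function for Hölder: `h * k = |h|^q` and `|k|^p = |h|^q`. It is not simple, so it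
  -- is approximated in `L^p` below.
  set k : X → ℂ := fun x => (starRingEnd ℂ) (h x) * ((‖h x‖ ^ (q - 2) : ℝ) : ℂ) with hk
  have hkn : ∀ x, ‖k x‖ = ‖h x‖ ^ (q - 1) := fun x => by
    simp only [hk, norm_mul, RCLike.norm_conj, Complex.norm_real]
    rw [Real.norm_of_nonneg (by positivity)]
    rcases eq_or_ne (h x) 0 with h0 | h0
    · simp [h0, Real.zero_rpow hq1.ne']
    · rw [mul_comm, ← Real.rpow_add_one (norm_ne_zero_iff.2 h0)]; ring_nf
  have hkm : AEStronglyMeasurable k μ := by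
    refine (Complex.continuous_conj.comp_aestronglyMeasurable hh.1).mul ?_
    exact Complex.continuous_ofReal.comp_aestronglyMeasurable
      (hh.1.norm.aemeasurable.pow_const _).aestronglyMeasurable
  have hke : eLpNorm k (ENNReal.ofReal p) μ = eLpNorm h (ENNReal.ofReal q) μ ^ (q - 1) := by
    have := eLpNorm_norm_rpow (p := ENNReal.ofReal p) (μ := μ) h hq1
    rw [← ENNReal.ofReal_mul hp0.le, hpq'] at this
    rw [← this]
    refine eLpNorm_congr_norm_ae (Eventually.of_forall fun x => ?_)
    rw [hkn, Real.norm_of_nonneg (by positivity)]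
  have hkL : MemLp k (ENNReal.ofReal p) μ :=
    ⟨hkm, by rw [hke]; exact ENNReal.rpow_lt_top_of_nonneg hq1.le hh.2.ne⟩
  have hint : ‖∫ x, h x * k x ∂μ‖ = N ^ q := by
    have e1 : ∀ x, h x * k x = ((‖h x‖ ^ q : ℝ) : ℂ) := fun x => by
      rcases eq_or_ne (h x) 0 with h0 | h0
      · simp [h0, Real.zero_rpow hq0.ne']
      · simp only [hk]
        rw [← mul_assoc, Complex.mul_conj, ← Complex.ofReal_mul, Complex.normSq_eq_norm_sq,
          ← Real.rpow_natCast, ← Real.rpow_add (norm_pos_iff.2 h0)]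
        congr 2; push_cast; ring
    have hqE : ENNReal.ofReal q ≠ 0 := by simpa using hq0
    simp_rw [e1]
    rw [integral_complex_ofReal, Complex.norm_real, hN,
      hh.eLpNorm_eq_integral_rpow_norm hqE ENNReal.ofReal_ne_top, ENNReal.toReal_ofReal hq0.le]
    have : 0 ≤ ∫ x, ‖h x‖ ^ q ∂μ := integral_nonneg fun x => by positivity
    rw [ENNReal.toReal_ofReal (by positivity), ← Real.rpow_mul this, inv_mul_cancel₀ hq0.ne',
      Real.rpow_one, Real.norm_of_nonneg this]
  have hle : N ^ q ≤ C * N ^ (q - 1) := by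
    refine le_of_forall_pos_le_add fun ε hε => ?_
    -- The approximation costs `(C + N) * δ`; the extra 1 keeps the denominator positive.
    set δ := ε / (C + N + 1) with hδ
    have hδ0 : 0 < δ := by positivity
    obtain ⟨g, hg, hgL⟩ := hkL.exists_simpleFunc_eLpNorm_sub_lt ENNReal.ofReal_ne_top
      (ε := ENNReal.ofReal δ) (by simpa using hδ0)
    have hgi : Integrable g μ := (SimpleFunc.memLp_iff_integrable hpE ENNReal.ofReal_ne_top).1 hgL
    have hd : (eLpNorm (k - ⇑g) (ENNReal.ofReal p) μ).toReal ≤ δ := by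
      rw [← ENNReal.toReal_ofReal hδ0.le]
      exact ENNReal.toReal_mono ENNReal.ofReal_ne_top hg.le
    have hgn : (eLpNorm g (ENNReal.ofReal p) μ).toReal ≤ N ^ (q - 1) + δ := by
      have e : (g : X → ℂ) = k - (k - ⇑g) := by simp
      have := eLpNorm_sub_le (μ := μ) hkm (hkm.sub hgL.1) hp1E
      rw [← e] at this
      have h2 := ENNReal.toReal_mono (ENNReal.add_ne_top.2 ⟨hkL.2.ne, (hkL.sub hgL).2.ne⟩) this
      rw [ENNReal.toReal_add hkL.2.ne (hkL.sub hgL).2.ne, hke, ← ENNReal.toReal_rpow] at h2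
      linarith
    have hsplit : ∫ x, h x * k x ∂μ = ∫ x, h x * g x ∂μ + ∫ x, h x * (k - ⇑g) x ∂μ := by
      rw [← integral_add]
      · refine integral_congr_ae (Eventually.of_forall fun x => ?_)
        simp only [Pi.sub_apply]; ring
      · exact hh.integrable_mul hgL
      · exact hh.integrable_mul (hkL.sub hgL)
    have h1 := hC g hgi
    have h2 := norm_integral_mul_le_eLpNorm hh (hkL.sub hgL)
    rw [← hint, hsplit]
    calc _ ≤ _ := norm_add_le _ _
      _ ≤ C * (N ^ (q - 1) + δ) + N * δ := by
          refine add_le_add (h1.trans ?_) (h2.trans ?_) <;> gcongr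
      _ = C * N ^ (q - 1) + (C + N) * δ := by ring
      _ ≤ C * N ^ (q - 1) + ε := by
          have : (C + N) * δ ≤ (C + N + 1) * δ :=
            mul_le_mul_of_nonneg_right (by linarith) hδ0.le
          have h4 : (C + N + 1) * δ = ε := by rw [hδ]; field_simp
          linarith
  rcases hN0.eq_or_lt with h0 | h0
  · rw [← h0]; exact hC0
  · have hpos : 0 < N ^ (q - 1) := by positivity
    have : N ^ q = N * N ^ (q - 1) := by
      rw [mul_comm, ← Real.rpow_add_one h0.ne']; ring_nf
    rw [this] at hle
    exact le_of_mul_le_mul_right hle hpos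

/-- The **Riesz–Thorin theorem** between `L¹ → L^∞` and `L² → L²`, on simple functions. -/
theorem IsL1L2Bounded.eLpNorm_simpleFunc_le {q : ℝ} (hF : IsL1L2Bounded μ M F)
    (hpq : p.HolderConjugate q) (hp2 : p ≤ 2) {f : SimpleFunc X ℂ} (hf : Integrable f μ) :
    eLpNorm (F f) (ENNReal.ofReal q) μ ≤
      ENNReal.ofReal (M ^ (2 / p - 1)) * eLpNorm f (ENNReal.ofReal p) μ := by
  have hq2 : 2 ≤ q := by
    have := hpq.mul_eq_add
    have := hpq.lt
    have := hpq.symm.lt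
    nlinarith
  have hfp := SimpleFunc.memLp_of_integrable hf (ENNReal.ofReal p)
  -- The duality argument divides by a power of the norm, so finiteness must be known beforehand.
  have hFq : MemLp (F f) (ENNReal.ofReal q) μ := MemLp.of_two_of_top
    (hF.memLp_two hf (SimpleFunc.memLp_of_integrable hf 2)) (hF.memLp_top hf) hq2
  have hM := hF.nonneg
  have h := eLpNorm_le_of_forall_simpleFunc hpq hFq
    (C := M ^ (2 / p - 1) * (eLpNorm f (ENNReal.ofReal p) μ).toReal) (by positivity)
    fun g hg => hF.norm_integral_mul_le hpq.lt.le hp2 hf hg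
  rw [← ENNReal.toReal_le_toReal hFq.2.ne (ENNReal.mul_ne_top ENNReal.ofReal_ne_top hfp.2.ne),
    ENNReal.toReal_mul, ENNReal.toReal_ofReal (by positivity)]
  exact h

end

/-! ### The fractional transform as a chirped Fourier transform. -/

/-- The unimodular function `exp (π i β t²)`. -/
noncomputable def chirp (β t : ℝ) : ℂ := Complex.exp ((Real.pi * β * t ^ 2 : ℝ) * Complex.I)

theorem norm_chirp (β t : ℝ) : ‖chirp β t‖ = 1 := Complex.norm_exp_ofReal_mul_I _

theorem continuous_chirp (β : ℝ) : Continuous (chirp β) := by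
  unfold chirp
  fun_prop

theorem memLp_chirp_mul {β : ℝ} {f : ℝ → ℂ} {p : ℝ≥0∞} (hf : MemLp f p) :
    MemLp (fun t => chirp β t * f t) p := by
  refine hf.congr_norm ((continuous_chirp β).aestronglyMeasurable.mul hf.1) ?_
  exact Eventually.of_forall fun t => by simp [norm_chirp]

theorem eLpNorm_chirp_mul (β : ℝ) (f : ℝ → ℂ) (p : ℝ≥0∞) :
    eLpNorm (fun t => chirp β t * f t) p volume = eLpNorm f p volume :=
  eLpNorm_congr_norm_ae (Eventually.of_forall fun t => by simp [norm_chirp])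

theorem sin_eq_zero_of_exists {α : ℝ} (h : Real.sin α = 0) :
    (∃ n : ℤ, α = 2 * n * Real.pi) ∨ ∃ n : ℤ, α = (2 * n + 1) * Real.pi := by
  obtain ⟨n, hn⟩ := Real.sin_eq_zero_iff.1 h
  rcases Int.even_or_odd' n with ⟨k, rfl | rfl⟩
  · exact Or.inl ⟨k, by rw [← hn]; push_cast; ring⟩
  · exact Or.inr ⟨k, by rw [← hn]; push_cast; ring⟩

theorem fracFourierL1_of_sin_ne_zero {α : ℝ} (h : Real.sin α ≠ 0) (f : ℝ → ℂ) (x : ℝ) :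
    fracFourierL1 α f x = ∫ t : ℝ, fracFourierKernel α x t * f t := by
  unfold fracFourierL1
  rw [if_neg, if_neg]
  · rintro ⟨n, rfl⟩
    refine h (Real.sin_eq_zero_iff.2 ⟨2 * n + 1, ?_⟩)
    push_cast; ring
  · rintro ⟨n, rfl⟩
    refine h (Real.sin_eq_zero_iff.2 ⟨2 * n, ?_⟩)
    push_cast; ring

open scoped FourierTransform in
theorem fracFourierL1_eq_fourier {α : ℝ} (h : Real.sin α ≠ 0) (f : ℝ → ℂ) :
    fracFourierL1 α f = fun x => fracFourierConst α * (chirp (Real.cot α) x *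
      𝓕 (fun t => chirp (Real.cot α) t * f t) ((Real.sin α)⁻¹ * x)) := by
  ext x
  rw [fracFourierL1_of_sin_ne_zero h, Real.fourier_real_eq_integral_exp_smul,
    ← integral_const_mul, ← integral_const_mul]
  refine integral_congr_ae (Eventually.of_forall fun t => ?_)
  simp only [fracFourierKernel, chirp, smul_eq_mul]
  rw [mul_assoc, ← mul_assoc (Complex.exp _) (Complex.exp _) (f t), ← mul_assoc (Complex.exp _)
    (_ * _) (f t), ← Complex.exp_add, ← Complex.exp_add]
  congr 3
  push_cast
  field_simp
  ring

/-- This is `|1 - i cot α|² = 1 + cot² α = 1 / sin² α`. -/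
theorem norm_fracFourierConst_sq {α : ℝ} (h : Real.sin α ≠ 0) :
    ‖fracFourierConst α‖ ^ 2 = |Real.sin α|⁻¹ := by
  have h1 : fracFourierConst α ^ 2 = 1 - Complex.I * (Real.cot α : ℂ) := by
    unfold fracFourierConst
    have := Complex.cpow_nat_inv_pow (1 - Complex.I * (Real.cot α : ℂ)) (n := 2) two_ne_zero
    rwa [Nat.cast_ofNat, ← one_div] at this
  rw [← norm_pow, h1, ← Real.sqrt_sq_eq_abs, ← Real.sqrt_inv, Complex.norm_def]
  congr 1
  rw [Complex.normSq_apply]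
  simp only [Complex.sub_re, Complex.one_re, Complex.mul_re, Complex.I_re, Complex.ofReal_re,
    Complex.I_im, Complex.ofReal_im, Complex.sub_im, Complex.one_im, Complex.mul_im]
  rw [Real.cot_eq_cos_div_sin]
  field_simp
  have := Real.sin_sq_add_cos_sq α
  linear_combination this

theorem eLpNorm_comp_mul_left_two {s : ℝ} (hs : s ≠ 0) {g : ℝ → ℂ}
    (hg : AEStronglyMeasurable g volume) :
    eLpNorm (fun x => g (s⁻¹ * x)) 2 volume =
      ENNReal.ofReal |s| ^ (1 / 2 : ℝ) * eLpNorm g 2 volume := by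
  have hm : Measure.map (s⁻¹ * ·) (volume : Measure ℝ) = ENNReal.ofReal |s| • volume := by
    rw [Real.map_volume_mul_left (inv_ne_zero hs), inv_inv]
  have := eLpNorm_map_measure (p := 2) (μ := (volume : Measure ℝ)) (f := (s⁻¹ * ·)) (g := g)
    (by rw [hm]; exact hg.smul_measure _) (by fun_prop)
  rw [hm, eLpNorm_smul_measure_of_ne_top ENNReal.ofNat_ne_top] at this
  rw [show (fun x => g (s⁻¹ * x)) = g ∘ (s⁻¹ * ·) from rfl, ← this]
  simp

theorem norm_fracFourierKernel (α x t : ℝ) : ‖fracFourierKernel α x t‖ = ‖fracFourierConst α‖ := by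
  unfold fracFourierKernel
  rw [norm_mul, show ∀ r : ℝ, (2 * Real.pi * Complex.I * (r : ℂ)) =
    ((2 * Real.pi * r : ℝ) : ℂ) * Complex.I from fun r => by push_cast; ring,
    Complex.norm_exp_ofReal_mul_I, mul_one]

theorem integrable_fracFourierKernel_mul {α : ℝ} {f : ℝ → ℂ} (hf : Integrable f) (x : ℝ) :
    Integrable fun t => fracFourierKernel α x t * f t := by
  refine hf.bdd_mul (c := ‖fracFourierConst α‖) ?_
    (Eventually.of_forall fun t => (norm_fracFourierKernel α x t).le)
  unfold fracFourierKernel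
  exact Continuous.aestronglyMeasurable (by fun_prop)

open scoped FourierTransform in
theorem isL1L2Bounded_fracFourierL1 {α : ℝ} (h : Real.sin α ≠ 0) :
    IsL1L2Bounded volume ‖fracFourierConst α‖ (fracFourierL1 α) where
  congr {f g} hfg := by
    refine Eventually.of_forall fun x => ?_
    rw [fracFourierL1_of_sin_ne_zero h, fracFourierL1_of_sin_ne_zero h]
    refine integral_congr_ae ?_
    filter_upwards [hfg] with t ht
    rw [ht]
  add {f g} hf hg := by
    refine Eventually.of_forall fun x => ?_
    simp only [Pi.add_apply, fracFourierL1_of_sin_ne_zero h, mul_add]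
    exact integral_add (integrable_fracFourierKernel_mul hf x)
      (integrable_fracFourierKernel_mul hg x)
  smul c f hf := by
    refine Eventually.of_forall fun x => ?_
    simp only [Pi.smul_apply, fracFourierL1_of_sin_ne_zero h, smul_eq_mul]
    rw [← integral_const_mul]
    exact integral_congr_ae (Eventually.of_forall fun t => by ring)
  aestronglyMeasurable {f} hf := by
    rw [fracFourierL1_eq_fourier h]
    have hc : Continuous (𝓕 (fun t => chirp (Real.cot α) t * f t)) :=
      VectorFourier.fourierIntegral_continuous Real.continuous_fourierChar continuous_inner
        (memLp_one_iff_integrable.1 (memLp_chirp_mul (memLp_one_iff_integrable.2 hf)))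
    have := continuous_chirp (Real.cot α)
    exact Continuous.aestronglyMeasurable (by fun_prop)
  eLpNorm_two_le {f} hf hf2 := by
    have hi := memLp_one_iff_integrable.1
      (memLp_chirp_mul (β := Real.cot α) (memLp_one_iff_integrable.2 hf))
    have hc : Continuous (𝓕 (fun t => chirp (Real.cot α) t * f t)) :=
      VectorFourier.fourierIntegral_continuous Real.continuous_fourierChar continuous_inner hi
    rw [fracFourierL1_eq_fourier h]
    have e := eLpNorm_const_smul (μ := (volume : Measure ℝ)) (p := 2) (fracFourierConst α)
      (fun x => chirp (Real.cot α) x *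
        𝓕 (fun t => chirp (Real.cot α) t * f t) ((Real.sin α)⁻¹ * x))
    refine le_of_eq (e.trans ?_)
    rw [eLpNorm_chirp_mul, eLpNorm_comp_mul_left_two h hc.aestronglyMeasurable,
      eLpNorm_fourier_two hi (memLp_chirp_mul hf2), eLpNorm_chirp_mul, ← mul_assoc]
    -- The normalisation `A_α` exactly compensates the dilation.
    have : ‖fracFourierConst α‖ₑ * ENNReal.ofReal |Real.sin α| ^ (1 / 2 : ℝ) = 1 := by
      rw [← ofReal_norm, ENNReal.ofReal_rpow_of_nonneg (abs_nonneg _) (by norm_num),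
        ← ENNReal.ofReal_mul (norm_nonneg _), ← Real.sqrt_eq_rpow,
        ← Real.sqrt_sq (norm_nonneg (fracFourierConst α)), norm_fracFourierConst_sq h,
        ← Real.sqrt_mul (by positivity), inv_mul_cancel₀ (abs_ne_zero.2 h)]
      simp
    rw [this, one_mul]
  nonneg := norm_nonneg _
  eLpNorm_top_le {f} hf := by
    rw [eLpNorm_exponent_top]
    refine eLpNormEssSup_le_of_ae_enorm_bound (Eventually.of_forall fun x => ?_)
    rw [fracFourierL1_of_sin_ne_zero h]
    refine (enorm_integral_le_lintegral_enorm _).trans_eq ?_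
    rw [eLpNorm_one_eq_lintegral_enorm, ← lintegral_const_mul'' _ hf.1.enorm]
    refine lintegral_congr fun t => ?_
    rw [enorm_mul, ← ofReal_norm (fracFourierKernel α x t), norm_fracFourierKernel]

theorem isL2Contraction_fracFourierL1 (α : ℝ) :
    IsL2Contraction volume (fracFourierL1 α) := by
  by_cases h : Real.sin α = 0
  swap
  · exact (isL1L2Bounded_fracFourierL1 h).toIsL2Contraction
  by_cases h0 : ∃ n : ℤ, α = 2 * n * Real.pi
  · have e : ∀ f, fracFourierL1 α f = f := fun f => by
      ext x; rw [fracFourierL1, if_pos h0]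
    exact
      { congr := fun hfg => by simpa only [e]
        add := fun _ _ => by simp only [e]; rfl
        smul := fun _ _ _ => by simp only [e]; rfl
        aestronglyMeasurable := fun hf => by simpa only [e] using hf.1
        eLpNorm_two_le := fun _ _ => by rw [e] }
  · have h1 := (sin_eq_zero_of_exists h).resolve_left h0
    have e : ∀ f, fracFourierL1 α f = f ∘ Neg.neg := fun f => by
      ext x; rw [fracFourierL1, if_neg h0, if_pos h1]; rfl
    have hneg : MeasurePreserving (Neg.neg : ℝ → ℝ) volume volume :=
      Measure.measurePreserving_neg volume
    exact
      { congr := fun hfg => by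
          simp only [e]; exact hneg.quasiMeasurePreserving.ae_eq_comp hfg
        add := fun _ _ => by simp only [e]; rfl
        smul := fun _ _ _ => by simp only [e]; rfl
        aestronglyMeasurable := fun hf => by
          simp only [e]; exact hf.1.comp_measurePreserving hneg
        eLpNorm_two_le := fun hf _ => by
          rw [e, eLpNorm_comp_measurePreserving hf.1 hneg] }

/-! ### The transform on `L²` by truncation. -/

section

variable {X : Type*} [MeasurableSpace X] {μ : Measure X}

/-- Dominated convergence in `L^r`. -/
theorem tendsto_eLpNorm_sub_of_norm_le {ι : Type*} {l : Filter ι} [l.IsCountablyGenerated]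
    {r : ℝ≥0∞} (hr0 : r ≠ 0) (hr : r ≠ ∞) {u : ι → X → ℂ} {f : X → ℂ}
    (hu : ∀ i, AEStronglyMeasurable (u i) μ) (hf : MemLp f r μ)
    (hbound : ∀ i x, ‖u i x‖ ≤ 2 * ‖f x‖)
    (hlim : ∀ x, Tendsto (fun i => u i x) l (𝓝 (f x))) :
    Tendsto (fun i => eLpNorm (u i - f) r μ) l (𝓝 0) := by
  have hr' : 0 < r.toReal := ENNReal.toReal_pos hr0 hr
  simp_rw [eLpNorm_eq_lintegral_rpow_enorm_toReal hr0 hr]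
  have key : Tendsto (fun i => ∫⁻ x, ‖(u i - f) x‖ₑ ^ r.toReal ∂μ) l (𝓝 0) := by
    rw [← lintegral_zero (μ := μ)]
    refine tendsto_lintegral_filter_of_dominated_convergence'
      -- The 3 comes from `‖u i x - f x‖ ≤ 2 ‖f x‖ + ‖f x‖`.
      (fun x => ‖(3 : ℂ) • f x‖ₑ ^ r.toReal) ?_ ?_ ?_ ?_
    · exact Eventually.of_forall fun i => ((hu i).sub hf.1).enorm.pow_const _
    · refine Eventually.of_forall fun i => Eventually.of_forall fun x => ?_
      refine ENNReal.rpow_le_rpow (enorm_le_iff_norm_le.2 ?_) hr'.le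
      rw [norm_smul, Pi.sub_apply]
      have := norm_sub_le (u i x) (f x)
      have := hbound i x
      norm_num
      linarith
    · exact (lintegral_rpow_enorm_lt_top_of_eLpNorm_lt_top hr0 hr (hf.const_smul (3 : ℂ)).2).ne
    · refine Eventually.of_forall fun x => ?_
      have h1 : Tendsto (fun i => ‖(u i - f) x‖ₑ) l (𝓝 0) := by
        have := ((hlim x).sub_const (f x)).enorm
        simpa using this
      have := (ENNReal.continuous_rpow_const (y := r.toReal)).continuousAt.tendsto.comp h1
      simpa [Function.comp_def, ENNReal.zero_rpow_of_pos hr'] using this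
  have := (ENNReal.continuous_rpow_const (y := 1 / r.toReal)).continuousAt.tendsto.comp key
  simpa [Function.comp_def, hr'] using this

end

theorem tendsto_eLpNorm_truncation_sub {f : ℝ → ℂ} (hf : MemLp f 2) :
    Tendsto (fun R : ℝ => eLpNorm ((Set.Icc (-R) R).indicator f - f) 2 volume) atTop (𝓝 0) := by
  refine tendsto_eLpNorm_sub_of_norm_le two_ne_zero ENNReal.ofNat_ne_top
    (fun R => hf.1.indicator measurableSet_Icc) hf (fun R x => ?_) fun x => ?_
  · have := norm_indicator_le_norm_self (s := Set.Icc (-R) R) f x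
    have := norm_nonneg (f x)
    linarith
  · refine tendsto_const_nhds.congr' ?_
    filter_upwards [eventually_ge_atTop |x|] with R hR
    rw [Set.indicator_of_mem (Set.mem_Icc.2 (abs_le.1 hR))]

theorem integrable_truncation {f : ℝ → ℂ} (hf : MemLp f 2) (R : ℝ) :
    Integrable ((Set.Icc (-R) R).indicator f) :=
  IntegrableOn.integrable_indicator ((hf.restrict _).integrable one_le_two) measurableSet_Icc

theorem memLp_truncation {f : ℝ → ℂ} (hf : MemLp f 2) (R : ℝ) :
    MemLp ((Set.Icc (-R) R).indicator f) 2 := hf.indicator measurableSet_Icc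

theorem memLp_fracFourierL1_truncation (α : ℝ) {f : ℝ → ℂ} (hf : MemLp f 2) (R : ℝ) :
    MemLp (fracFourierL1 α ((Set.Icc (-R) R).indicator f)) 2 :=
  (isL2Contraction_fracFourierL1 α).memLp_two (integrable_truncation hf R) (memLp_truncation hf R)

namespace IsFracFourierL2

variable {α : ℝ} {f f' g g' : ℝ → ℂ}

/-- The contraction is applied to truncation errors. This consistency of the two definitions on `L¹
∩ L²` makes the transform on `L¹ + L²` well defined. -/
theorem of_integrable (hf : Integrable f) (hf2 : MemLp f 2) :
    IsFracFourierL2 α f (fracFourierL1 α f) := by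
  have hF := isL2Contraction_fracFourierL1 α
  refine ⟨hF.memLp_two hf hf2, tendsto_of_tendsto_of_tendsto_of_le_of_le tendsto_const_nhds
    (tendsto_eLpNorm_truncation_sub hf2) (fun _ => zero_le) fun R => ?_⟩
  have h := hF.sub (integrable_truncation hf2 R) hf
  exact (eLpNorm_congr_ae h).symm.trans_le (hF.eLpNorm_two_le
    ((integrable_truncation hf2 R).sub hf) ((memLp_truncation hf2 R).sub hf2))

theorem congr (h : IsFracFourierL2 α f g) (hff' : f =ᵐ[volume] f') : IsFracFourierL2 α f' g := by
  refine ⟨h.1, h.2.congr fun R => eLpNorm_congr_ae ?_⟩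
  have h1 : (Set.Icc (-R) R).indicator f =ᵐ[volume] (Set.Icc (-R) R).indicator f' := by
    filter_upwards [hff'] with x hx
    simp only [Set.indicator_apply, hx]
  filter_upwards [(isL2Contraction_fracFourierL1 α).congr h1] with x hx
  rw [hx]

theorem unique (hf : MemLp f 2) (h : IsFracFourierL2 α f g) (h' : IsFracFourierL2 α f g') :
    g =ᵐ[volume] g' := by
  have hlim := h.2.add h'.2
  rw [add_zero] at hlim
  have h0 : eLpNorm (g' - g) 2 volume = 0 := by
    refine le_antisymm (ge_of_tendsto' hlim fun R => ?_) zero_le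
    have hm := memLp_fracFourierL1_truncation α hf R
    have := eLpNorm_sub_le (p := 2) (μ := volume) (hm.1.sub h.1.1) (hm.1.sub h'.1.1) one_le_two
    rw [sub_sub_sub_cancel_left] at this
    exact this
  have := (eLpNorm_eq_zero_iff (h'.1.1.sub h.1.1) two_ne_zero).1 h0
  filter_upwards [this] with x hx
  exact (sub_eq_zero.1 hx).symm

theorem add (hf : MemLp f 2) (hf' : MemLp f' 2) (h : IsFracFourierL2 α f g)
    (h' : IsFracFourierL2 α f' g') : IsFracFourierL2 α (f + f') (g + g') := by
  have hlim := h.2.add h'.2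
  rw [add_zero] at hlim
  refine ⟨h.1.add h'.1, tendsto_of_tendsto_of_tendsto_of_le_of_le tendsto_const_nhds
    hlim (fun _ => zero_le) fun R => ?_⟩
  have e := (isL2Contraction_fracFourierL1 α).add (integrable_truncation hf R)
    (integrable_truncation hf' R)
  rw [← Set.indicator_add'] at e
  refine le_trans (le_of_eq (eLpNorm_congr_ae ?_)) (eLpNorm_add_le (p := 2) (μ := volume)
    ((memLp_fracFourierL1_truncation α hf R).1.sub h.1.1)
    ((memLp_fracFourierL1_truncation α hf' R).1.sub h'.1.1) one_le_two)
  filter_upwards [e] with x hx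
  simp only [hx, Pi.add_apply]
  ring

theorem const_smul (c : ℂ) (hf : MemLp f 2) (h : IsFracFourierL2 α f g) :
    IsFracFourierL2 α (c • f) (c • g) := by
  have hlim := ENNReal.Tendsto.const_mul (a := ‖c‖ₑ) h.2 (Or.inr enorm_ne_top)
  rw [mul_zero] at hlim
  refine ⟨h.1.const_smul c, hlim.congr fun R => ?_⟩
  have e := (isL2Contraction_fracFourierL1 α).smul c (integrable_truncation hf R)
  have hi : (Set.Icc (-R) R).indicator (c • f) = c • (Set.Icc (-R) R).indicator f :=
    Set.indicator_const_smul _ c f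
  rw [← eLpNorm_const_smul]
  refine eLpNorm_congr_ae ?_
  filter_upwards [e] with x hx
  simp only [hi, hx, Pi.smul_apply, smul_eq_mul]
  ring

theorem sub (hf : MemLp f 2) (hf' : MemLp f' 2) (h : IsFracFourierL2 α f g)
    (h' : IsFracFourierL2 α f' g') : IsFracFourierL2 α (f - f') (g - g') := by
  have := h.add hf (hf'.const_smul (-1 : ℂ)) (h'.const_smul (-1) hf')
  simpa [sub_eq_add_neg] using this

/-- The truncations are Cauchy in `L²`, hence so are their transforms; completeness supplies the
limit, and the norm bound passes to it. -/
theorem exists_eLpNorm_le (α : ℝ) (hf : MemLp f 2) :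
    ∃ g, IsFracFourierL2 α f g ∧ eLpNorm g 2 volume ≤ eLpNorm f 2 volume := by
  have hF := isL2Contraction_fracFourierL1 α
  have hm := memLp_fracFourierL1_truncation α hf
  set H : ℝ → Lp ℂ 2 (volume : Measure ℝ) := fun R => (memLp_truncation hf R).toLp _ with hH
  set G : ℝ → Lp ℂ 2 (volume : Measure ℝ) := fun R => (hm R).toLp _ with hG
  have hHlim : Tendsto H atTop (𝓝 (hf.toLp f)) :=
    (Lp.tendsto_Lp_iff_tendsto_eLpNorm'' _ (memLp_truncation hf) f hf).2
      (tendsto_eLpNorm_truncation_sub hf)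
  have hdist : ∀ R S, dist (G R) (G S) ≤ dist (H R) (H S) := fun R S => by
    rw [dist_edist, dist_edist, Lp.edist_toLp_toLp, Lp.edist_toLp_toLp]
    refine ENNReal.toReal_mono ((memLp_truncation hf R).sub (memLp_truncation hf S)).2.ne ?_
    rw [← eLpNorm_congr_ae (hF.sub (integrable_truncation hf R) (integrable_truncation hf S))]
    exact hF.eLpNorm_two_le ((integrable_truncation hf R).sub (integrable_truncation hf S))
      ((memLp_truncation hf R).sub (memLp_truncation hf S))
  have hG' : CauchySeq G := by
    have hc := hHlim.cauchySeq
    rw [Metric.cauchySeq_iff] at hc ⊢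
    intro ε hε
    obtain ⟨N, hN⟩ := hc ε hε
    exact ⟨N, fun m hm n hn => (hdist m n).trans_lt (hN m hm n hn)⟩
  obtain ⟨L, hL⟩ := cauchySeq_tendsto_of_complete hG'
  refine ⟨L, ⟨Lp.memLp L, ?_⟩, ?_⟩
  · have := (Lp.tendsto_Lp_iff_tendsto_eLpNorm' G L).1 hL
    refine this.congr fun R => eLpNorm_congr_ae ?_
    filter_upwards [(hm R).coeFn_toLp] with x hx
    simp only [hG, Pi.sub_apply, hx]
  · have hle : ‖L‖ ≤ ‖hf.toLp f‖ := le_of_tendsto_of_tendsto' hL.norm hHlim.norm fun R => by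
      rw [Lp.norm_toLp, Lp.norm_toLp]
      exact ENNReal.toReal_mono (memLp_truncation hf R).2.ne
        (hF.eLpNorm_two_le (integrable_truncation hf R) (memLp_truncation hf R))
    rwa [Lp.norm_toLp, Lp.norm_def, ENNReal.toReal_le_toReal (Lp.eLpNorm_ne_top L) hf.2.ne] at hle

theorem eLpNorm_le (hf : MemLp f 2) (h : IsFracFourierL2 α f g) :
    eLpNorm g 2 volume ≤ eLpNorm f 2 volume := by
  obtain ⟨g', hg', hle⟩ := exists_eLpNorm_le α hf
  rwa [eLpNorm_congr_ae (h.unique hf hg')]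

end IsFracFourierL2

/-! ### The transform on `L¹ + L²`. -/

namespace IsFracFourier

variable {α : ℝ} {f f' g g' : ℝ → ℂ}

theorem congr (h : IsFracFourier α f g) (hf : f' =ᵐ[volume] f) (hg : g' =ᵐ[volume] g) :
    IsFracFourier α f' g' := by
  obtain ⟨f₁, f₂, g₂, h1, h2, h3, h4, h5⟩ := h
  exact ⟨f₁, f₂, g₂, h1, h2, hf.trans h3, h4, hg.trans h5⟩

theorem of_memLp_two (hf : MemLp f 2) (h : IsFracFourierL2 α f g) : IsFracFourier α f g := by
  refine ⟨0, f, g, MemLp.zero, hf, by simp, h, ?_⟩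
  filter_upwards [(isL2Contraction_fracFourierL1 α).zero] with x hx
  simp [hx]

theorem unique (h : IsFracFourier α f g) (h' : IsFracFourier α f g') : g =ᵐ[volume] g' := by
  obtain ⟨f₁, f₂, g₂, h1, h2, h3, h4, h5⟩ := h
  obtain ⟨f₁', f₂', g₂', h1', h2', h3', h4', h5'⟩ := h'
  rw [memLp_one_iff_integrable] at h1 h1'
  have hF := isL2Contraction_fracFourierL1 α
  -- The left side is in `L¹` and the right side in `L²`, so the common difference has both
  -- transforms and they agree.
  have e : f₁ - f₁' =ᵐ[volume] f₂' - f₂ := by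
    filter_upwards [h3, h3'] with x hx hx'
    rw [hx] at hx'
    simp only [Pi.add_apply, Pi.sub_apply] at hx' ⊢
    linear_combination hx'
  have hd := h2'.sub h2
  have h6 := (IsFracFourierL2.of_integrable (α := α) (h1.sub h1') (hd.ae_eq e.symm)).congr e
  filter_upwards [h5, h5', h6.unique hd (h4'.sub h2' h2 h4), hF.sub h1 h1'] with x a b c d
  rw [d] at c
  rw [a, b]
  simp only [Pi.add_apply, Pi.sub_apply] at c ⊢
  linear_combination c

theorem add (h : IsFracFourier α f g) (h' : IsFracFourier α f' g') :
    IsFracFourier α (f + f') (g + g') := by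
  obtain ⟨f₁, f₂, g₂, h1, h2, h3, h4, h5⟩ := h
  obtain ⟨f₁', f₂', g₂', h1', h2', h3', h4', h5'⟩ := h'
  refine ⟨f₁ + f₁', f₂ + f₂', g₂ + g₂', h1.add h1', h2.add h2', ?_, h4.add h2 h2' h4', ?_⟩
  · filter_upwards [h3, h3'] with x a b
    simp only [Pi.add_apply, a, b]; ring
  · rw [memLp_one_iff_integrable] at h1 h1'
    filter_upwards [h5, h5', (isL2Contraction_fracFourierL1 α).add h1 h1'] with x a b c
    simp only [Pi.add_apply, a, b, c]; ring

theorem const_smul (c : ℂ) (h : IsFracFourier α f g) : IsFracFourier α (c • f) (c • g) := by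
  obtain ⟨f₁, f₂, g₂, h1, h2, h3, h4, h5⟩ := h
  refine ⟨c • f₁, c • f₂, c • g₂, h1.const_smul c, h2.const_smul c, ?_, h4.const_smul c h2, ?_⟩
  · filter_upwards [h3] with x a
    simp only [Pi.add_apply, Pi.smul_apply, a, smul_add]
  · rw [memLp_one_iff_integrable] at h1
    filter_upwards [h5, (isL2Contraction_fracFourierL1 α).smul c h1] with x a b
    simp only [Pi.add_apply, Pi.smul_apply, a, b, smul_add]

end IsFracFourier

/-! ### Extension from simple functions to `L^p`. -/

/-- The part of an `L^p` function where it is large is integrable. -/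
theorem MemLp.integrable_indicator_one_lt {X : Type*} [MeasurableSpace X] {μ : Measure X} {p : ℝ}
    (hp : 1 ≤ p) {f : X → ℂ} (hfm : StronglyMeasurable f) (hf : MemLp f (ENNReal.ofReal p) μ) :
    Integrable ({x | 1 < ‖f x‖}.indicator f) μ := by
  have hp0 : 0 < p := by linarith
  have hint := hf.integrable_norm_rpow (by simpa using hp0) ENNReal.ofReal_ne_top
  rw [ENNReal.toReal_ofReal hp0.le] at hint
  refine hint.mono' (hfm.aestronglyMeasurable.indicator
    (measurableSet_lt measurable_const hfm.norm.measurable)) (Eventually.of_forall fun x => ?_)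
  by_cases hx : 1 < ‖f x‖
  · rw [Set.indicator_of_mem (show x ∈ {x | 1 < ‖f x‖} from hx)]
    exact Real.self_le_rpow_of_one_le hx.le hp
  · rw [Set.indicator_of_notMem (by simpa using hx), norm_zero]
    positivity

/-- The part of an `L^p` function where it is small is square integrable, for `p ≤ 2`. -/
theorem MemLp.memLp_two_indicator_compl {X : Type*} [MeasurableSpace X] {μ : Measure X} {p : ℝ}
    (hp0 : 0 < p) (hp2 : p ≤ 2) {f : X → ℂ} (hfm : StronglyMeasurable f)
    (hf : MemLp f (ENNReal.ofReal p) μ) :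
    MemLp ({x | 1 < ‖f x‖}ᶜ.indicator f) 2 μ := by
  have hint := hf.integrable_norm_rpow (by simpa using hp0) ENNReal.ofReal_ne_top
  rw [ENNReal.toReal_ofReal hp0.le] at hint
  have hm : AEStronglyMeasurable ({x | 1 < ‖f x‖}ᶜ.indicator f) μ :=
    hfm.aestronglyMeasurable.indicator
      (measurableSet_lt measurable_const hfm.norm.measurable).compl
  rw [← integrable_norm_rpow_iff hm two_ne_zero ENNReal.ofNat_ne_top, ENNReal.toReal_ofNat]
  refine hint.mono' (hm.norm.aemeasurable.pow_const _).aestronglyMeasurable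
    (Eventually.of_forall fun x => ?_)
  rw [Real.norm_of_nonneg (by positivity)]
  by_cases hx : 1 < ‖f x‖
  · rw [Set.indicator_of_notMem (by simpa using hx), norm_zero, Real.zero_rpow two_ne_zero]
    positivity
  · rw [Set.indicator_of_mem (by simpa using hx)]
    exact Real.rpow_le_rpow_of_exponent_ge' (norm_nonneg _) (not_lt.1 hx) hp0.le hp2

/-- `L¹` convergence is mapped to almost everywhere convergence. -/
theorem IsL1L2Bounded.tendsto_ae {X : Type*} [MeasurableSpace X] {μ : Measure X} {M : ℝ}
    {F : (X → ℂ) → X → ℂ} (hF : IsL1L2Bounded μ M F) {v : ℕ → X → ℂ} {f : X → ℂ}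
    (hv : ∀ n, Integrable (v n) μ) (hf : Integrable f μ)
    (hlim : Tendsto (fun n => eLpNorm (v n - f) 1 μ) atTop (𝓝 0)) :
    ∀ᵐ x ∂μ, Tendsto (fun n => F (v n) x) atTop (𝓝 (F f x)) := by
  have h2 := ENNReal.Tendsto.const_mul (a := ENNReal.ofReal M) hlim (Or.inr ENNReal.ofReal_ne_top)
  rw [mul_zero] at h2
  have hle : ∀ᵐ x ∂μ, ∀ n, ‖F (v n) x - F f x‖ₑ ≤
      ENNReal.ofReal M * eLpNorm (v n - f) 1 μ := by
    refine ae_all_iff.2 fun n => ?_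
    filter_upwards [hF.sub (hv n) hf, ae_le_eLpNormEssSup (f := F (v n - f))] with x a b
    rw [a, ← eLpNorm_exponent_top] at b
    exact b.trans (hF.eLpNorm_top_le ((hv n).sub hf))
  filter_upwards [hle] with x hx
  rw [tendsto_iff_edist_tendsto_0]
  refine tendsto_of_tendsto_of_tendsto_of_le_of_le tendsto_const_nhds h2 (fun _ => zero_le)
    fun n => ?_
  rw [edist_eq_enorm_sub]
  exact hx n

/-- `L²` convergence of integrable functions is mapped to convergence in measure. -/
theorem IsFracFourierL2.tendstoInMeasure {α : ℝ} {f g : ℝ → ℂ} (hg : IsFracFourierL2 α f g)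
    (hf : MemLp f 2) {v : ℕ → ℝ → ℂ} (hv : ∀ n, Integrable (v n)) (hv2 : ∀ n, MemLp (v n) 2)
    (hlim : Tendsto (fun n => eLpNorm (v n - f) 2 volume) atTop (𝓝 0)) :
    TendstoInMeasure volume (fun n => fracFourierL1 α (v n)) atTop g := by
  refine tendstoInMeasure_of_tendsto_eLpNorm (p := 2) two_ne_zero
    (fun n => (isL2Contraction_fracFourierL1 α).aestronglyMeasurable (hv n)) hg.1.1
    (tendsto_of_tendsto_of_tendsto_of_le_of_le tendsto_const_nhds hlim (fun _ => zero_le)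
      fun n => ?_)
  exact ((IsFracFourierL2.of_integrable (hv n) (hv2 n)).sub (hv2 n) hf hg).eLpNorm_le
    ((hv2 n).sub hf)

/-- The Hausdorff–Young inequality for a measurable function. -/
theorem exists_isFracFourier_of_stronglyMeasurable {α p q : ℝ} (h : Real.sin α ≠ 0)
    (hpq : p.HolderConjugate q) (hp2 : p ≤ 2) {f : ℝ → ℂ} (hfm : StronglyMeasurable f)
    (hf : MemLp f (ENNReal.ofReal p)) :
    ∃ g, IsFracFourier α f g ∧ AEStronglyMeasurable g volume ∧
      eLpNorm g (ENNReal.ofReal q) volume ≤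
        ENNReal.ofReal (‖fracFourierConst α‖ ^ (2 / p - 1)) *
          eLpNorm f (ENNReal.ofReal p) volume := by
  have hB := isL1L2Bounded_fracFourierL1 h
  have hF := hB.toIsL2Contraction
  have hp0 := hpq.pos
  have hpE : ENNReal.ofReal p ≠ 0 := by simpa using hp0
  set S := {x | 1 < ‖f x‖} with hS
  have hSm : MeasurableSet S := measurableSet_lt measurable_const hfm.norm.measurable
  have hf1 : Integrable (S.indicator f) := MemLp.integrable_indicator_one_lt hpq.lt.le hfm hf
  have hf2 : MemLp (Sᶜ.indicator f) 2 := MemLp.memLp_two_indicator_compl hp0 hp2 hfm hf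
  obtain ⟨g₂, hg₂, -⟩ := IsFracFourierL2.exists_eLpNorm_le α hf2
  have hsep : TopologicalSpace.SeparableSpace (Set.range f ∪ {0} : Set ℂ) :=
    StronglyMeasurable.separableSpace_range_union_singleton hfm
  -- Base point 0 gives `‖u n‖ ≤ 2 ‖f‖`, so dominated convergence applies on both `S` and its
  -- complement.
  set u : ℕ → SimpleFunc ℝ ℂ := fun n =>
    SimpleFunc.approxOn f hfm.measurable (Set.range f ∪ {0}) 0 (by simp) n with hu
  have hu_lim : ∀ x, Tendsto (fun n => u n x) atTop (𝓝 (f x)) := fun x =>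
    SimpleFunc.tendsto_approxOn hfm.measurable (by simp) (subset_closure (by simp))
  have hu_le : ∀ n x, ‖u n x‖ ≤ 2 * ‖f x‖ := fun n x => by
    rw [two_mul]; exact SimpleFunc.norm_approxOn_zero_le hfm.measurable (by simp) x n
  have hu_mem : ∀ n, MemLp (u n) (ENNReal.ofReal p) := fun n =>
    SimpleFunc.memLp_approxOn_range hfm.measurable hf n
  have hu_int : ∀ n, Integrable (u n) := fun n =>
    (SimpleFunc.memLp_iff_integrable hpE ENNReal.ofReal_ne_top).1 (hu_mem n)
  have hu_two : ∀ n, MemLp (u n) 2 := fun n => SimpleFunc.memLp_of_integrable (hu_int n) 2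
  have hu_norm := SimpleFunc.tendsto_approxOn_range_Lp_eLpNorm ENNReal.ofReal_ne_top
    hfm.measurable hf.2
  have hind : ∀ (A : Set ℝ) (n : ℕ) (x : ℝ),
      ‖A.indicator (u n) x‖ ≤ 2 * ‖A.indicator f x‖ := fun A n x => by
    by_cases hx : x ∈ A
    · simpa [hx] using hu_le n x
    · simp [hx]
  have hind_lim : ∀ (A : Set ℝ) (x : ℝ),
      Tendsto (fun n => A.indicator (u n) x) atTop (𝓝 (A.indicator f x)) := fun A x => by
    by_cases hx : x ∈ A
    · simpa [hx] using hu_lim x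
    · simp [hx]
  have lim1 : ∀ᵐ x, Tendsto (fun n => fracFourierL1 α (S.indicator (u n)) x) atTop
      (𝓝 (fracFourierL1 α (S.indicator f) x)) := by
    have l1 := tendsto_eLpNorm_sub_of_norm_le one_ne_zero ENNReal.one_ne_top
      (fun n => (hu_int n).1.indicator hSm) (memLp_one_iff_integrable.2 hf1) (hind S) (hind_lim S)
    exact hB.tendsto_ae (fun n => (hu_int n).indicator hSm) hf1 l1
  have lim2 : TendstoInMeasure volume (fun n => fracFourierL1 α (Sᶜ.indicator (u n))) atTop g₂ := by
    have l1 := tendsto_eLpNorm_sub_of_norm_le two_ne_zero ENNReal.ofNat_ne_top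
      (fun n => (hu_int n).1.indicator hSm.compl) hf2 (hind Sᶜ) (hind_lim Sᶜ)
    exact hg₂.tendstoInMeasure hf2 (fun n => (hu_int n).indicator hSm.compl)
      (fun n => (hu_two n).indicator hSm.compl) l1
  -- The `L²` part is only known to converge in measure, hence the subsequence.
  obtain ⟨ns, hns, lim2'⟩ := lim2.exists_seq_tendsto_ae
  have hadd : ∀ᵐ x, ∀ n, fracFourierL1 α (u n) x =
      fracFourierL1 α (S.indicator (u n)) x + fracFourierL1 α (Sᶜ.indicator (u n)) x := by
    refine ae_all_iff.2 fun n => ?_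
    have := hF.add ((hu_int n).indicator hSm) ((hu_int n).indicator hSm.compl)
    rwa [Set.indicator_self_add_compl] at this
  have hm : AEStronglyMeasurable (fracFourierL1 α (S.indicator f) + g₂) volume :=
    (hF.aestronglyMeasurable hf1).add hg₂.1.1
  refine ⟨fracFourierL1 α (S.indicator f) + g₂, ⟨S.indicator f, Sᶜ.indicator f, g₂,
    memLp_one_iff_integrable.2 hf1, hf2, ?_, hg₂, EventuallyEq.rfl⟩, hm, ?_⟩
  · rw [Set.indicator_self_add_compl]
  have hlim : ∀ᵐ x, Tendsto (fun k => fracFourierL1 α (u (ns k)) x) atTop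
      (𝓝 ((fracFourierL1 α (S.indicator f) + g₂) x)) := by
    filter_upwards [lim1, lim2', hadd] with x a b c
    simp only [c]
    exact (a.comp hns.tendsto_atTop).add b
  -- Fatou: the bound for simple functions survives almost everywhere limits.
  refine (Lp.eLpNorm_lim_le_liminf_eLpNorm (p := ENNReal.ofReal q)
    (fun k => hF.aestronglyMeasurable (hu_int (ns k))) _ hlim).trans ?_
  have hbd : ∀ k, eLpNorm (fracFourierL1 α (u (ns k))) (ENNReal.ofReal q) volume ≤
      ENNReal.ofReal (‖fracFourierConst α‖ ^ (2 / p - 1)) *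
        (eLpNorm f (ENNReal.ofReal p) volume +
          eLpNorm (⇑(u (ns k)) - f) (ENNReal.ofReal p) volume) := fun k => by
    refine (hB.eLpNorm_simpleFunc_le hpq hp2 (hu_int (ns k))).trans ?_
    gcongr
    have := eLpNorm_add_le (p := ENNReal.ofReal p) (μ := volume) hf.1
      ((hu_mem (ns k)).1.sub hf.1) (by simpa using hpq.lt.le)
    rwa [add_sub_cancel] at this
  have hT := ENNReal.Tendsto.const_mul (a := ENNReal.ofReal (‖fracFourierConst α‖ ^ (2 / p - 1)))
    ((hu_norm.comp hns.tendsto_atTop).const_add (eLpNorm f (ENNReal.ofReal p) volume))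
    (Or.inr ENNReal.ofReal_ne_top)
  rw [add_zero] at hT
  rw [← hT.liminf_eq]
  exact liminf_le_liminf (Eventually.of_forall hbd)

/-! ### The bounded operator from `L^p` to `L^p'`. -/

theorem exists_isFracFourier {α p : ℝ} (hp : 1 < p) (hp2 : p ≤ 2)
    (hα : p = 2 ∨ ∀ n : ℤ, α ≠ n * Real.pi) {f : ℝ → ℂ} (hf : MemLp f (ENNReal.ofReal p)) :
    ∃ g, IsFracFourier α f g ∧ MemLp g (ENNReal.ofReal (p / (p - 1))) ∧
      eLpNorm g (ENNReal.ofReal (p / (p - 1))) volume ≤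
        ENNReal.ofReal (‖fracFourierConst α‖ ^ (2 / p - 1)) *
          eLpNorm f (ENNReal.ofReal p) volume := by
  rcases hα with rfl | hα
  -- Here `p' = 2` and the exponent `2 / p - 1` vanishes, so the constant is 1 whatever `α` is.
  · norm_num at hf ⊢
    obtain ⟨g, hg, hle⟩ := IsFracFourierL2.exists_eLpNorm_le α hf
    exact ⟨g, .of_memLp_two hf hg, hg.1, hle⟩
  · have h : Real.sin α ≠ 0 := fun h0 => by
      obtain ⟨n, hn⟩ := Real.sin_eq_zero_iff.1 h0
      exact hα n hn.symm
    have hpq : p.HolderConjugate (p / (p - 1)) :=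
      (Real.holderConjugate_iff_eq_conjExponent hp).2 rfl
    obtain ⟨g, hg, hgm, hle⟩ := exists_isFracFourier_of_stronglyMeasurable h hpq hp2
      hf.1.stronglyMeasurable_mk (hf.ae_eq hf.1.ae_eq_mk)
    rw [← eLpNorm_congr_ae hf.1.ae_eq_mk] at hle
    exact ⟨g, hg.congr hf.1.ae_eq_mk EventuallyEq.rfl, ⟨hgm, hle.trans_lt
      (ENNReal.mul_lt_top ENNReal.ofReal_lt_top hf.2)⟩, hle⟩

/-- For `1 < p ≤ 2` and `p' = p / (p - 1)`, and for `α ∉ πℤ` (any real `α` if `p = 2`), the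
fractional Fourier transform is a well-defined (`↔`: every `f ∈ Lᵖ` has a transform, unique up to
null sets and independent of the decomposition) bounded linear operator from `Lᵖ(ℝ)` to `Lᵖ'(ℝ)`,
with bound `|A_α| ^ (2/p - 1)`. -/
theorem mainTheorem2 (α p : ℝ) (hp : 1 < p) (hp2 : p ≤ 2)
    (hα : p = 2 ∨ ∀ n : ℤ, α ≠ n * Real.pi) :
    ∃ T : Lp ℂ (ENNReal.ofReal p) (volume : Measure ℝ) →ₗ[ℂ]
        Lp ℂ (ENNReal.ofReal (p / (p - 1))) (volume : Measure ℝ),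
      (∀ (f : Lp ℂ (ENNReal.ofReal p) (volume : Measure ℝ)) (g : ℝ → ℂ),
        IsFracFourier α f g ↔ g =ᵐ[volume] T f) ∧
      ∀ f : Lp ℂ (ENNReal.ofReal p) (volume : Measure ℝ),
        ‖T f‖ ≤ ‖fracFourierConst α‖ ^ (2 / p - 1) * ‖f‖ := by
  -- The choice of representatives is arbitrary; linearity follows from uniqueness of the transform.
  choose G hG hGm hGle using fun f : Lp ℂ (ENNReal.ofReal p) (volume : Measure ℝ) =>
    exists_isFracFourier hp hp2 hα (Lp.memLp f)
  have hT : ∀ f : Lp ℂ (ENNReal.ofReal p) (volume : Measure ℝ),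
      IsFracFourier α f ((hGm f).toLp (G f)) := fun f =>
    (hG f).congr EventuallyEq.rfl (hGm f).coeFn_toLp
  refine ⟨{ toFun := fun f => (hGm f).toLp (G f), map_add' := fun f g => ?_,
            map_smul' := fun c f => ?_ }, fun f g => ⟨fun h => h.unique (hT f), fun h =>
            (hT f).congr EventuallyEq.rfl h⟩, fun f => ?_⟩
  · refine Lp.ext ?_
    exact (hT (f + g)).unique
      (((hT f).add (hT g)).congr (Lp.coeFn_add f g) (Lp.coeFn_add _ _))
  · refine Lp.ext ?_
    exact (hT (c • f)).unique (((hT f).const_smul c).congr (Lp.coeFn_smul c f) (Lp.coeFn_smul _ _))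
  · have := ENNReal.toReal_mono (ENNReal.mul_ne_top ENNReal.ofReal_ne_top (Lp.eLpNorm_ne_top f))
      (hGle f)
    rw [ENNReal.toReal_mul, ENNReal.toReal_ofReal (by positivity)] at this
    exact (Lp.norm_toLp (G f) (hGm f)).trans_le this
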